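/- Let $a,b,q$ be complex numbers with $a\neq 0$, $q\ne 0$, $|q|<1$, $|ab|<1$ and $|a^2q|<1$. For $x\in\mathbb C$ let $H(x)$ be the $J$-fraction $$H(x)=\cfrac{1-ab}{x(1-ab)+(1-ab)+\cfrac{(a-bq)(b-aq)}{x(1-ab)+(1-ab)q^2+\cfrac{(a-bq^3)(b-aq^3)}{x(1-ab)+(1-ab)q^4+\cfrac{(a-bq^5)(b-aq^5)}{x(1-ab)+(1-ab)q^6+\cdots}}}}$$ Convergence of a continued fraction means convergence of its convergents in the extended complex plane $\mathbb C\cup\{\infty\}$, and a continued fraction terminates at a vanishing partial numerator. Write $${}_2\phi_1(A,B;C;p,z)=\sum_{k=0}^\infty \frac{(A;p)_k(B;p)_k}{(p;p)_k(C;p)_k}z^k,\qquad (A;p)_k=\prod_{j=0}^{k-1}(1-Ap^j).$$ Then the continued fraction $H(1)$ converges, and $$H(1)=\frac{1-ab}{2}\cdot\frac{{}_2\phi_1\left(-\frac{bq}{a},\frac{bq}{a};-q^2;q^2,a^2q\right)}{{}_2\phi_1\left(-\frac{bq}{a},\frac{b}{aq};-1;q^2,a^2q\right)}.$$ Here both series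 converge, and their sums are not both zero; the value is $\infty$ when the denominator is zero. -/

import Mathlib

open Filter Topology

noncomputable section

/-- The finite `q`-rising factorial `(a; q)_n = (1 - a)(1 - a q) ⋯ (1 - a q^(n-1))`. -/
def qRising (a q : ℂ) (n : ℕ) : ℂ :=
  ∏ j ∈ Finset.range n, (1 - a * q ^ j)

/-- The `k`-th term of the basic hypergeometric series `₂φ₁(A, B; C; p, z)`. -/
def twoPhiOneTerm (A B C p z : ℂ) (k : ℕ) : ℂ :=
  qRising A p k * qRising B p k / (qRising p p k * qRising C p k) * z ^ k

/-- The sum of the basic hypergeometric series `₂φ₁(A, B; C; p, z)`. -/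
def twoPhiOne (A B C p z : ℂ) : ℂ :=
  ∑' k : ℕ, twoPhiOneTerm A B C p z k

/-- The quotient `z / w` as an extended complex number, with `z / 0 = ∞`
(meaningful for `(z, w) ≠ (0, 0)`). -/
def extDiv (z w : ℂ) : OnePoint ℂ :=
  if w = 0 then OnePoint.infty else ((z / w : ℂ) : OnePoint ℂ)

/-- The map `w ↦ α / (β + w)` of the extended complex plane to itself, for `α ≠ 0`.
For `α = 0` it is the constant map `0`: a continued fraction terminates at a vanishing
partial numerator. -/
def cfMap (α β : ℂ) (w : OnePoint ℂ) : OnePoint ℂ :=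
  if α = 0 then ((0 : ℂ) : OnePoint ℂ)
  else w.elim ((0 : ℂ) : OnePoint ℂ) (fun z => extDiv α (β + z))

/-- `S_n(w) = β₀ + α₁/(β₁ + α₂/(β₂ + ⋯ + α_n/(β_n + w)))` on the extended complex plane:
`S_0(w) = β₀ + w` and `S_{n+1}(w) = S_n(α_{n+1} / (β_{n+1} + w))`. The value `α 0` is not used. -/
def cfApprox (α β : ℕ → ℂ) : ℕ → OnePoint ℂ → OnePoint ℂ
  | 0, w => OnePoint.map (fun z => β 0 + z) w
  | n + 1, w => cfApprox α β n (cfMap (α (n + 1)) (β (n + 1)) w)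

/-- The continued fraction `β₀ + α₁/(β₁ + α₂/(β₂ + ⋯))` converges to the extended complex
number `S`: its convergents `S_n(0)` tend to `S` on the Riemann sphere. -/
def CFConvergesTo (α β : ℕ → ℂ) (S : OnePoint ℂ) : Prop :=
  Tendsto (fun n => cfApprox α β n ((0 : ℂ) : OnePoint ℂ)) atTop (𝓝 S)

/-- The partial numerators of `H(x)`: `1 - ab`, then `(a - b q^(2n+1)) (b - a q^(2n+1))`
for `n = 0, 1, 2, …`. (Index `0` is a dummy.) -/
def hNum (a b q : ℂ) : ℕ → ℂ
  | 0 => 0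
  | 1 => 1 - a * b
  | n + 2 => (a - b * q ^ (2 * n + 1)) * (b - a * q ^ (2 * n + 1))

/-- The partial denominators of `H(x)`: `β₀ = 0`, and `x (1 - ab) + (1 - ab) q^(2n)` below the
`n`-th partial numerator counted from `n = 0`. -/
def hDen (a b q x : ℂ) : ℕ → ℂ
  | 0 => 0
  | n + 1 => x * (1 - a * b) + (1 - a * b) * q ^ (2 * n)

/-- `H(x)` converges to the extended complex number `S`. -/
def HConvergesTo (a b q x : ℂ) (S : OnePoint ℂ) : Prop :=
  CFConvergesTo (hNum a b q) (hDen a b q x) S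

end

/-!
Write `p = q²`, `A = -bq/a`, `z = a²q`, so that `ab = -Az/p`, and let
`F_n = ₂φ₁(A, -A pⁿ⁻¹; -pⁿ; p, z)`. The series in the denominator and the numerator of the claimed
value are `F_0` and `F_1`. Comparing coefficients of powers of `z` (`twoPhiOneTerm_contiguous`) gives
`F_n = (1 - ab) F_{n+1} + γ_n F_{n+2}` with `γ_n = α_{n+2} / ((1 + pⁿ)(1 + pⁿ⁺¹))`
(`contiguousSeries_recurrence`), where `α` are the partial numerators of `H(1)`. Thus
`F_n / (-1; p)_n` solves the recurrence of the continued fraction backwards.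

By dominated convergence `F_n` tends to `g = ₁φ₀(A; p, z)` (`tendsto_contiguousSeries`), and `g ≠ 0`
because the `q`-binomial functional equation would carry a zero at `z` to the points `pⁿ z`, hence to
the origin, where the value is `1` (`twoPhiOne_zero_zero_ne_zero`).

Let `X_n` be the numerators or the denominators of the convergents, divided by `(-1; p)_n`. The
pairing `X_{n+1} F_{n+1} + γ_n X_n F_{n+2}` is a constant `I` (`cfRec_pairing`). Since `F_n → g ≠ 0` and
`γ_n → ab` with `|ab| < 1`, this is an affine recursion for `X_n` with a convergent, eventually
contracting slope, so `X_n → I / (g (1 + ab))`. The constants are `I = (1 - ab) F_1 / 2` for the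
numerators and `I = F_0` for the denominators, which gives the value
(`cfConvergesTo_of_backward_solution`). This argument is insensitive to vanishing partial numerators:
a convergent is the quotient of its numerator and denominator whenever these are not both zero, also
after termination (`cfApprox_zero_eq_extDiv`).

Finally, if `F_0 = F_1 = 0`, the recurrence forces `F_n = 0` for all `n`, contradicting `g ≠ 0`, unless
some `γ_n` vanishes. There the parameters degenerate, and `F_{n+1}` is either `1` or a nonvanishing
`₁φ₀` (`contiguousSeries_succ_ne_zero`).
-/

/-! ### Affine recursions and ratio tests -/

/-- An affine recursion whose coefficients converge, with limiting slope `v` of norm less than one,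
converges to the fixed point of the limiting affine map. -/
theorem tendsto_of_affine_recursion {x u v : ℕ → ℂ} {u₀ v₀ : ℂ}
    (hx : ∀ᶠ n in atTop, x (n + 1) = u n + v n * x n)
    (hu : Tendsto u atTop (𝓝 u₀)) (hv : Tendsto v atTop (𝓝 v₀)) (hv₀ : ‖v₀‖ < 1) :
    Tendsto x atTop (𝓝 (u₀ / (1 - v₀))) := by
  have h1 : 1 - v₀ ≠ 0 := by
    intro h
    rw [← sub_eq_zero.mp h] at hv₀
    simp at hv₀
  set l := u₀ / (1 - v₀) with hl
  obtain ⟨ρ, hρ, hρ1⟩ := exists_between hv₀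
  have hρ0 : 0 ≤ ρ := (norm_nonneg _).trans hρ.le
  have he : Tendsto (fun n => u n + v n * l - l) atTop (𝓝 0) := by
    have : u₀ + v₀ * l - l = 0 := by rw [hl]; field_simp; ring
    rw [← this]
    exact (hu.add (hv.mul_const l)).sub_const l
  rw [Metric.tendsto_atTop]
  intro ε hε
  have hev : ∀ᶠ n in atTop, ‖x (n + 1) - l‖ ≤ ρ * ‖x n - l‖ + (1 - ρ) * (ε / 2) := by
    have hδ : 0 < (1 - ρ) * (ε / 2) := mul_pos (sub_pos.mpr hρ1) (half_pos hε)
    filter_upwards [hx, hv.norm.eventually (gt_mem_nhds hρ),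
      (tendsto_zero_iff_norm_tendsto_zero.mp he).eventually (gt_mem_nhds hδ)] with n hn hvn hen
    have : x (n + 1) - l = v n * (x n - l) + (u n + v n * l - l) := by rw [hn]; ring
    rw [this]
    refine (norm_add_le _ _).trans (add_le_add ?_ hen.le)
    rw [norm_mul]
    exact mul_le_mul_of_nonneg_right hvn.le (norm_nonneg _)
  obtain ⟨N, hN⟩ := eventually_atTop.mp hev
  have hk : ∀ k, ‖x (N + k) - l‖ ≤ ρ ^ k * ‖x N - l‖ + ε / 2 := by
    intro k
    induction k with
    | zero => simpa using (half_pos hε).le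
    | succ k ih =>
      have := hN (N + k) (Nat.le_add_right _ _)
      rw [← add_assoc]
      refine this.trans ?_
      have := mul_le_mul_of_nonneg_left ih hρ0
      rw [pow_succ]
      linarith
  have hlim : Tendsto (fun k => ρ ^ k * ‖x N - l‖) atTop (𝓝 0) := by
    simpa using (tendsto_pow_atTop_nhds_zero_of_lt_one hρ0 hρ1).mul_const ‖x N - l‖
  obtain ⟨K, hK⟩ := eventually_atTop.mp (hlim.eventually (gt_mem_nhds (half_pos hε)))
  refine ⟨N + K, fun n hn => ?_⟩
  obtain ⟨k, rfl⟩ := Nat.exists_eq_add_of_le ((Nat.le_add_right N K).trans hn)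
  rw [dist_eq_norm]
  have := hK k (by omega)
  have := hk k
  linarith

theorem summable_of_tendsto_ratio {𝕜 : Type*} [NormedField 𝕜] [CompleteSpace 𝕜] {f ρ : ℕ → 𝕜}
    {z : 𝕜} (h : ∀ k, f (k + 1) = ρ k * f k) (hρ : Tendsto ρ atTop (𝓝 z)) (hz : ‖z‖ < 1) :
    Summable f := by
  obtain ⟨r, hr, hr1⟩ := exists_between hz
  refine summable_of_ratio_norm_eventually_le hr1 ?_
  filter_upwards [hρ.norm.eventually (gt_mem_nhds hr)] with n hn
  rw [h, norm_mul]
  exact mul_le_mul_of_nonneg_right hn.le (norm_nonneg _)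

/-! ### Rising factorials and basic hypergeometric series -/

theorem qRising_zero (a p : ℂ) : qRising a p 0 = 1 := by simp [qRising]

theorem qRising_succ (a p : ℂ) (k : ℕ) :
    qRising a p (k + 1) = qRising a p k * (1 - a * p ^ k) := by
  simp [qRising, Finset.prod_range_succ]

theorem qRising_succ_left (a p : ℂ) (k : ℕ) :
    qRising a p (k + 1) = (1 - a) * qRising (a * p) p k := by
  simp only [qRising, Finset.prod_range_succ', pow_zero, mul_one, pow_succ']
  rw [mul_comm]
  simp only [mul_assoc]

theorem qRising_zero_left (p : ℂ) (k : ℕ) : qRising 0 p k = 1 := by simp [qRising]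

theorem qRising_one_succ (p : ℂ) (k : ℕ) : qRising 1 p (k + 1) = 0 := by
  simp [qRising_succ_left]

theorem qRising_ne_zero {a p : ℂ} (h : ∀ j : ℕ, 1 - a * p ^ j ≠ 0) (k : ℕ) :
    qRising a p k ≠ 0 :=
  Finset.prod_ne_zero_iff.mpr fun j _ => h j

theorem continuous_qRising (p : ℂ) (k : ℕ) : Continuous fun a => qRising a p k := by
  unfold qRising
  fun_prop

theorem one_sub_pow_succ_ne_zero {p : ℂ} (hp : ‖p‖ < 1) (k : ℕ) : 1 - p ^ (k + 1) ≠ 0 := by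
  intro h
  have h1 : ‖p ^ (k + 1)‖ < 1 := by
    rw [norm_pow]; exact pow_lt_one₀ (norm_nonneg _) hp (Nat.succ_ne_zero k)
  rw [← sub_eq_zero.mp h] at h1
  simp at h1

theorem one_add_pow_ne_zero {p : ℂ} (hp : ‖p‖ < 1) (k : ℕ) : 1 + p ^ k ≠ 0 := by
  cases k with
  | zero => norm_num
  | succ k =>
    intro h
    have h1 : ‖p ^ (k + 1)‖ < 1 := by
      rw [norm_pow]; exact pow_lt_one₀ (norm_nonneg _) hp (Nat.succ_ne_zero k)
    rw [← norm_neg, ← eq_neg_of_add_eq_zero_left h] at h1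
    simp at h1

theorem qRising_self_ne_zero {p : ℂ} (hp : ‖p‖ < 1) (k : ℕ) : qRising p p k ≠ 0 :=
  qRising_ne_zero (fun j => by simpa [pow_succ'] using one_sub_pow_succ_ne_zero hp j) k

theorem twoPhiOneTerm_zero (A B C p z : ℂ) : twoPhiOneTerm A B C p z 0 = 1 := by
  simp [twoPhiOneTerm, qRising_zero]

theorem twoPhiOneTerm_succ (A B C p z : ℂ) (k : ℕ) :
    twoPhiOneTerm A B C p z (k + 1) =
      (1 - A * p ^ k) * (1 - B * p ^ k) / ((1 - p * p ^ k) * (1 - C * p ^ k)) * z *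
        twoPhiOneTerm A B C p z k := by
  simp only [twoPhiOneTerm, qRising_succ, pow_succ, div_eq_mul_inv, mul_inv]
  ring

theorem tendsto_mul_pow {p : ℂ} (hp : ‖p‖ < 1) (c : ℂ) :
    Tendsto (fun k : ℕ => c * p ^ k) atTop (𝓝 0) := by
  simpa using (tendsto_pow_atTop_nhds_zero_of_norm_lt_one hp).const_mul c

theorem summable_twoPhiOneTerm (A B C : ℂ) {p z : ℂ} (hp : ‖p‖ < 1) (hz : ‖z‖ < 1) :
    Summable (twoPhiOneTerm A B C p z) := by
  refine summable_of_tendsto_ratio (twoPhiOneTerm_succ A B C p z) ?_ hz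
  have h (c : ℂ) : Tendsto (fun k : ℕ => 1 - c * p ^ k) atTop (𝓝 1) := by
    simpa using (tendsto_mul_pow hp c).const_sub 1
  simpa using (((h A).mul (h B)).div ((h p).mul (h C)) (by simp)).mul_const z

/-! ### The series `₁φ₀` and its nonvanishing -/

/-- The functional equation behind the `q`-binomial theorem; `₁φ₀(A; p, z)` is encoded as
`₂φ₁(A, 0; 0; p, z)`. -/
theorem one_sub_mul_twoPhiOne_zero_zero (A : ℂ) {p z : ℂ} (hp : ‖p‖ < 1) (hz : ‖z‖ < 1) :
    (1 - z) * twoPhiOne A 0 0 p z = (1 - A * z) * twoPhiOne A 0 0 p (p * z) := by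
  have hpz : ‖p * z‖ < 1 := by
    rw [norm_mul]; exact mul_lt_one_of_nonneg_of_lt_one_left (norm_nonneg _) hp hz.le
  have h1 := summable_twoPhiOneTerm A 0 0 hp hz
  have h2 := summable_twoPhiOneTerm A 0 0 hp hpz
  have hterm (k : ℕ) : twoPhiOneTerm A 0 0 p z (k + 1) - twoPhiOneTerm A 0 0 p (p * z) (k + 1) =
      z * twoPhiOneTerm A 0 0 p z k - A * z * twoPhiOneTerm A 0 0 p (p * z) k := by
    have hk := one_sub_pow_succ_ne_zero hp k
    have hq := qRising_self_ne_zero hp k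
    simp only [twoPhiOneTerm, qRising_succ, qRising_zero_left, mul_pow, ← pow_succ']
    field_simp
    ring
  have h3 : twoPhiOne A 0 0 p z - twoPhiOne A 0 0 p (p * z) =
      z * twoPhiOne A 0 0 p z - A * z * twoPhiOne A 0 0 p (p * z) := by
    simp only [twoPhiOne]
    rw [← tsum_mul_left, ← tsum_mul_left, ← (h1.mul_left z).tsum_sub (h2.mul_left _),
      ← h1.tsum_sub h2, (h1.sub h2).tsum_eq_zero_add]
    simp only [hterm, twoPhiOneTerm_zero, sub_self, zero_add]
  linear_combination h3

theorem twoPhiOne_zero_zero_ne_zero {A p z : ℂ} (hp : ‖p‖ < 1) (hz : ‖z‖ < 1)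
    (hAz : ‖A * z‖ < 1) : twoPhiOne A 0 0 p z ≠ 0 := by
  intro h0
  have hpow (n : ℕ) : ‖p ^ n‖ ≤ 1 := by
    rw [norm_pow]; exact pow_le_one₀ (norm_nonneg _) hp.le
  -- A zero at `z` propagates to all points `pⁿ z`, which accumulate at the origin.
  have hn (n : ℕ) : twoPhiOne A 0 0 p (p ^ n * z) = 0 := by
    induction n with
    | zero => simpa using h0
    | succ n ih =>
      have hz' : ‖p ^ n * z‖ < 1 := by
        rw [norm_mul]; exact mul_lt_one_of_nonneg_of_lt_one_right (hpow n) (norm_nonneg _) hz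
      have h := one_sub_mul_twoPhiOne_zero_zero A hp hz'
      rw [ih, mul_zero, ← mul_assoc p, ← pow_succ'] at h
      refine (mul_eq_zero.mp h.symm).resolve_left fun h1 => ?_
      have h2 : ‖A * (p ^ n * z)‖ < 1 := by
        rw [mul_left_comm, norm_mul]
        exact mul_lt_one_of_nonneg_of_lt_one_right (hpow n) (norm_nonneg _) hAz
      rw [← sub_eq_zero.mp h1] at h2
      simp at h2
  have hlim : Tendsto (fun n : ℕ => twoPhiOne A 0 0 p (p ^ n * z)) atTop
      (𝓝 (∑' k : ℕ, if k = 0 then 1 else 0)) := by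
    refine tendsto_tsum_of_dominated_convergence (summable_twoPhiOneTerm A 0 0 hp hz).norm
      (fun k => ?_) (Eventually.of_forall fun n k => ?_)
    · have h1 : Tendsto (fun n : ℕ => p ^ n * z) atTop (𝓝 0) := by
        simpa [mul_comm] using tendsto_mul_pow hp z
      have h2 := (h1.pow k).const_mul (qRising A p k * qRising 0 p k /
        (qRising p p k * qRising 0 p k))
      refine h2.trans_eq ?_
      rcases k with _ | k <;> simp [qRising_zero]
    · simp only [twoPhiOneTerm]
      rw [norm_mul, norm_mul]
      refine mul_le_mul_of_nonneg_left ?_ (norm_nonneg _)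
      rw [mul_pow, norm_mul, norm_pow]
      exact mul_le_of_le_one_left (norm_nonneg _) (pow_le_one₀ (norm_nonneg _) (hpow n))
  simp only [hn, tsum_ite_eq] at hlim
  exact zero_ne_one (tendsto_nhds_unique tendsto_const_nhds hlim)

/-! ### The contiguous relation and its large-index limit -/

/-- The coefficientwise form of `contiguousSeries_recurrence`, with `t` in place of `pⁿ`. -/
theorem twoPhiOneTerm_contiguous {A p t : ℂ} (z : ℂ) (hp0 : p ≠ 0) (hp : ‖p‖ < 1)
    (ht : ∀ j : ℕ, 1 + t * p ^ j ≠ 0) (k : ℕ) :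
    twoPhiOneTerm A (-(A * t / p)) (-t) p z (k + 1) =
      twoPhiOneTerm A (-(A * (t * p) / p)) (-(t * p)) p z (k + 1) +
        (A * z / p * twoPhiOneTerm A (-(A * (t * p) / p)) (-(t * p)) p z k -
        z * (1 + A * t) * (A + p * t) / (p * ((1 + t) * (1 + t * p))) *
          twoPhiOneTerm A (-(A * (t * p ^ 2) / p)) (-(t * p ^ 2)) p z k) := by
  have hB1 : -(A * (t * p) / p) = -(A * t) := by field_simp
  have hB2 : -(A * (t * p ^ 2) / p) = -(A * t) * p := by field_simp
  have hB0 : -(A * t / p) * p = -(A * t) := by field_simp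
  have ht0 : 1 + t ≠ 0 := by simpa using ht 0
  have ht1 : 1 + t * p ≠ 0 := by simpa using ht 1
  have htk : 1 + t * p * p ^ k ≠ 0 := by simpa [pow_succ', mul_assoc] using ht (k + 1)
  have hk := one_sub_pow_succ_ne_zero hp k
  have hP := qRising_self_ne_zero hp k
  have hV : qRising (-(t * p)) p k ≠ 0 := qRising_ne_zero (fun j => by
    simpa [pow_succ', mul_assoc] using ht (j + 1)) k
  -- Every rising factorial in play is a multiple of `(-At; p)_k` or `(-tp; p)_k`.
  have hU2 : (1 + A * t) * qRising (-(A * t) * p) p k =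
      qRising (-(A * t)) p k * (1 + A * t * p ^ k) := by
    have := (qRising_succ_left (-(A * t)) p k).symm.trans (qRising_succ _ _ _)
    linear_combination this
  have hV2 : qRising (-(t * p ^ 2)) p k =
      qRising (-(t * p)) p k * (1 + t * p * p ^ k) / (1 + t * p) := by
    have := (qRising_succ_left (-(t * p)) p k).symm.trans (qRising_succ _ _ _)
    rw [show -(t * p) * p = -(t * p ^ 2) by ring] at this
    rw [eq_div_iff ht1]
    linear_combination this
  have hlast : z * (1 + A * t) * (A + p * t) / (p * ((1 + t) * (1 + t * p))) *
      twoPhiOneTerm A (-(A * t) * p) (-(t * p ^ 2)) p z k =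
      z * (A + p * t) / (p * ((1 + t) * (1 + t * p))) *
        (qRising A p k * (qRising (-(A * t)) p k * (1 + A * t * p ^ k)) /
          (qRising p p k * qRising (-(t * p ^ 2)) p k) * z ^ k) := by
    rw [← hU2, twoPhiOneTerm]; ring
  rw [hB1, hB2, hlast, hV2]
  simp only [twoPhiOneTerm]
  rw [qRising_succ_left (-(A * t / p)), hB0, qRising_succ_left (-t), qRising_succ A,
    qRising_succ p, qRising_succ (-(A * t)), qRising_succ (-(t * p)), neg_mul t p,
    sub_neg_eq_add, sub_neg_eq_add, neg_mul, neg_mul, sub_neg_eq_add, sub_neg_eq_add,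
    ← pow_succ' p k, pow_succ z]
  generalize qRising A p k = a
  generalize qRising (-(A * t)) p k = u at *
  generalize qRising (-(t * p)) p k = v at *
  generalize qRising p p k = w at *
  have hk' : 1 - p * p ^ k ≠ 0 := by rwa [← pow_succ']
  rw [pow_succ']
  generalize p ^ k = s at *
  -- `field_simp` looks these denominators up in its own ordering of the variables.
  have hk'' : 1 - s * p ≠ 0 := by rwa [mul_comm]
  have htk' : 1 + s * t * p ≠ 0 := by rwa [mul_assoc, mul_comm s]
  field_simp
  ring

/-- The series `F_n = ₂φ₁(A, -A pⁿ⁻¹; -pⁿ; p, z)` to which the tails of the continued fraction are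
proportional. The second parameter is written as a quotient so that `n = 0` is covered. -/
noncomputable def contiguousSeries (A p z : ℂ) (n : ℕ) : ℂ :=
  twoPhiOne A (-(A * p ^ n / p)) (-p ^ n) p z

theorem contiguousSeries_recurrence {A p z : ℂ} (hp0 : p ≠ 0) (hp : ‖p‖ < 1) (hz : ‖z‖ < 1)
    (n : ℕ) :
    contiguousSeries A p z n = (1 + A * z / p) * contiguousSeries A p z (n + 1) -
      z * (1 + A * p ^ n) * (A + p ^ (n + 1)) / (p * ((1 + p ^ n) * (1 + p ^ (n + 1)))) *
        contiguousSeries A p z (n + 2) := by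
  have ht (j : ℕ) : 1 + p ^ n * p ^ j ≠ 0 := by
    rw [← pow_add]; exact one_add_pow_ne_zero hp _
  have hs (n : ℕ) := summable_twoPhiOneTerm A (-(A * p ^ n / p)) (-p ^ n) hp hz
  have hterm := twoPhiOneTerm_contiguous (A := A) z hp0 hp ht
  simp only [← pow_succ, ← pow_succ', ← pow_add] at hterm
  simp only [contiguousSeries, twoPhiOne]
  have h0 := (hs n).tsum_eq_zero_add
  have h1 := (hs (n + 1)).tsum_eq_zero_add
  simp only [hterm, twoPhiOneTerm_zero] at h0 h1
  have hs1 := (summable_nat_add_iff 1).mpr (hs (n + 1))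
  have e1 := (hs (n + 1)).mul_left (A * z / p)
  have e2 := (hs (n + 2)).mul_left
    (z * (1 + A * p ^ n) * (A + p ^ (n + 1)) / (p * ((1 + p ^ n) * (1 + p ^ (n + 1)))))
  rw [hs1.tsum_add (e1.sub e2), e1.tsum_sub e2, tsum_mul_left, tsum_mul_left] at h0
  linear_combination h0 - h1

theorem tendsto_contiguousSeries {A p z : ℂ} (hp0 : p ≠ 0) (hp : ‖p‖ < 1) (hz : ‖z‖ < 1) :
    Tendsto (contiguousSeries A p z) atTop (𝓝 (twoPhiOne A 0 0 p z)) := by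
  rw [← tendsto_add_atTop_iff_nat 1]
  have hB (n : ℕ) : -(A * p ^ (n + 1) / p) = -(A * p ^ n) := by
    rw [pow_succ]; field_simp
  have hr (j : ℕ) : 0 < 1 - ‖p‖ ^ (j + 1) :=
    sub_pos.mpr (pow_lt_one₀ (norm_nonneg _) hp (Nat.succ_ne_zero j))
  simp only [contiguousSeries, hB, twoPhiOne]
  refine tendsto_tsum_of_dominated_convergence
    (bound := fun k => ‖twoPhiOneTerm A 0 0 p z k‖ *
      ∏ j ∈ Finset.range k, (1 + ‖A‖ * ‖p‖ ^ j) / (1 - ‖p‖ ^ (j + 1))) ?_ (fun k => ?_)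
    (Eventually.of_forall fun n k => ?_)
  · have h0 : Tendsto (fun k : ℕ => ‖p‖ ^ k) atTop (𝓝 0) :=
      tendsto_pow_atTop_nhds_zero_of_lt_one (norm_nonneg _) hp
    refine summable_of_tendsto_ratio (z := ‖z‖) (ρ := fun k =>
      ‖(1 - A * p ^ k) * (1 - 0 * p ^ k) / ((1 - p * p ^ k) * (1 - 0 * p ^ k)) * z‖ *
        ((1 + ‖A‖ * ‖p‖ ^ k) / (1 - ‖p‖ ^ (k + 1)))) (fun k => ?_) ?_ (by simpa using hz)
    · rw [twoPhiOneTerm_succ, Finset.prod_range_succ, norm_mul]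
      ring
    · have h (c : ℂ) : Tendsto (fun k : ℕ => 1 - c * p ^ k) atTop (𝓝 1) := by
        simpa using (tendsto_mul_pow hp c).const_sub 1
      have h1 := ((((h A).mul (h 0)).div ((h p).mul (h 0)) (by simp)).mul_const z).norm
      have h2 : Tendsto (fun k : ℕ => (1 + ‖A‖ * ‖p‖ ^ k) / (1 - ‖p‖ ^ (k + 1))) atTop (𝓝 1) := by
        have h3 := ((h0.const_mul ‖A‖).const_add 1).div
          (((tendsto_add_atTop_iff_nat 1).mpr h0).const_sub 1) (by simp)
        exact h3.trans_eq (by simp)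
      simpa using h1.mul h2
  · have h1 : Tendsto (fun n : ℕ => -(A * p ^ n)) atTop (𝓝 0) := by
      simpa using (tendsto_mul_pow hp A).neg
    have h2 : Tendsto (fun n : ℕ => -p ^ (n + 1)) atTop (𝓝 0) := by
      simpa using ((tendsto_add_atTop_iff_nat 1).mpr (tendsto_mul_pow hp 1)).neg
    have h3 := ((continuous_qRising p k).tendsto 0).comp h1
    have h4 := ((continuous_qRising p k).tendsto 0).comp h2
    refine (((h3.const_mul (qRising A p k)).div (h4.const_mul (qRising p p k)) ?_).mul_const _)
    simpa [qRising_zero_left] using qRising_self_ne_zero hp k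
  · have hfac : ‖qRising (-(A * p ^ n)) p k / qRising (-p ^ (n + 1)) p k‖ ≤
        ∏ j ∈ Finset.range k, (1 + ‖A‖ * ‖p‖ ^ j) / (1 - ‖p‖ ^ (j + 1)) := by
      rw [qRising, qRising, ← Finset.prod_div_distrib, norm_prod]
      refine Finset.prod_le_prod (fun _ _ => norm_nonneg _) fun j _ => ?_
      have hpn : ‖p‖ ^ n ≤ 1 := pow_le_one₀ (norm_nonneg _) hp.le
      rw [norm_div]
      refine div_le_div₀ (by positivity) ?_ (hr j) ?_
      · refine (norm_sub_le _ _).trans ?_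
        simp only [norm_one, norm_mul, norm_neg, norm_pow]
        gcongr
        exact mul_le_of_le_one_right (norm_nonneg _) hpn
      · have h5 := norm_sub_norm_le (1 : ℂ) (-p ^ (n + 1) * p ^ j)
        simp only [norm_one, norm_mul, norm_neg, norm_pow] at h5
        refine le_trans ?_ h5
        have : ‖p‖ ^ (n + 1) * ‖p‖ ^ j = ‖p‖ ^ n * ‖p‖ ^ (j + 1) := by ring
        rw [this]
        have := mul_le_of_le_one_left (pow_nonneg (norm_nonneg p) (j + 1)) hpn
        linarith
    have hsplit : twoPhiOneTerm A (-(A * p ^ n)) (-p ^ (n + 1)) p z k =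
        twoPhiOneTerm A 0 0 p z k *
          (qRising (-(A * p ^ n)) p k / qRising (-p ^ (n + 1)) p k) := by
      simp only [twoPhiOneTerm, qRising_zero_left, div_eq_mul_inv, mul_inv]
      ring
    rw [hsplit, norm_mul]
    exact mul_le_mul_of_nonneg_left hfac (norm_nonneg _)

/-! ### Convergents on the Riemann sphere -/

theorem extDiv_mul_right {k : ℂ} (hk : k ≠ 0) (u v : ℂ) :
    extDiv (u * k) (v * k) = extDiv u v := by
  by_cases hv : v = 0
  · simp [extDiv, hv]
  · simp [extDiv, hv, hk, mul_div_mul_right]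

theorem cfMap_extDiv {α : ℂ} (hα : α ≠ 0) (β : ℂ) {u v : ℂ} (h : u ≠ 0 ∨ v ≠ 0) :
    cfMap α β (extDiv u v) = extDiv (α * v) (β * v + u) := by
  by_cases hv : v = 0
  · have hu : u ≠ 0 := by simpa [hv] using h
    simp [cfMap, extDiv, hα, hv, hu]
  · have h1 : β * v + u = (β + u / v) * v := by field_simp
    rw [h1, extDiv_mul_right hv]
    simp [cfMap, extDiv, hα, hv]

theorem tendsto_extDiv {x y : ℕ → ℂ} {x₀ y₀ : ℂ} (hx : Tendsto x atTop (𝓝 x₀))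
    (hy : Tendsto y atTop (𝓝 y₀)) (h : x₀ ≠ 0 ∨ y₀ ≠ 0) :
    Tendsto (fun n => extDiv (x n) (y n)) atTop (𝓝 (extDiv x₀ y₀)) := by
  by_cases hy₀ : y₀ = 0
  · have hx₀ : x₀ ≠ 0 := by simpa [hy₀] using h
    subst hy₀
    rw [extDiv, if_pos rfl]
    intro s hs
    rw [OnePoint.nhds_infty_eq, Filter.mem_sup, Filter.mem_map, Filter.mem_pure,
      coclosedCompact_eq_cocompact] at hs
    obtain ⟨hs, hs'⟩ := hs
    rw [← Metric.cobounded_eq_cocompact, ← comap_norm_atTop, Filter.mem_comap] at hs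
    obtain ⟨t, ht, hts⟩ := hs
    obtain ⟨R, hR⟩ := mem_atTop_sets.mp ht
    have hRy : Tendsto (fun n => R * ‖y n‖) atTop (𝓝 0) := by
      simpa using hy.norm.const_mul R
    have hev := hRy.eventually_lt hx.norm (norm_pos_iff.mpr hx₀)
    change ∀ᶠ n in atTop, extDiv (x n) (y n) ∈ s
    filter_upwards [hev] with n hn
    by_cases hyn : y n = 0
    · simpa [extDiv, hyn] using hs'
    · rw [extDiv, if_neg hyn]
      refine hts (hR _ ?_)
      rw [norm_div]
      exact ((lt_div_iff₀ (norm_pos_iff.mpr hyn)).mpr hn).le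
  · rw [extDiv, if_neg hy₀]
    refine ((OnePoint.continuous_coe.tendsto (x₀ / y₀)).comp (hx.div hy hy₀)).congr' ?_
    filter_upwards [hy.eventually_ne hy₀] with n hn
    simp [extDiv, hn]

/-- The solution `R` with `R 0 = x`, `R 1 = y` of the three-term recurrence
`R (n + 2) = β (n + 1) R (n + 1) + α (n + 1) R n` of a continued fraction. In the classical indexing
`A₋₁, A₀, A₁, …` of numerators and denominators of convergents, `R (n + 1)` is the `n`-th one. -/
def cfRec (α β : ℕ → ℂ) (x y : ℂ) : ℕ → ℂ
  | 0 => x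
  | 1 => y
  | n + 2 => β (n + 1) * cfRec α β x y (n + 1) + α (n + 1) * cfRec α β x y n

theorem cfRec_add_two (α β : ℕ → ℂ) (x y : ℂ) (n : ℕ) :
    cfRec α β x y (n + 2) = β (n + 1) * cfRec α β x y (n + 1) + α (n + 1) * cfRec α β x y n :=
  rfl

/-- `S_n` acts on homogeneous coordinates through the matrix of two consecutive convergents, also
past a vanishing partial numerator, as long as the image is not `(0, 0)`. -/
theorem cfApprox_extDiv (α β : ℕ → ℂ) (n : ℕ) (u v : ℂ)
    (h : cfRec α β 1 (β 0) (n + 1) * v + cfRec α β 1 (β 0) n * u ≠ 0 ∨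
      cfRec α β 0 1 (n + 1) * v + cfRec α β 0 1 n * u ≠ 0) :
    cfApprox α β n (extDiv u v) =
      extDiv (cfRec α β 1 (β 0) (n + 1) * v + cfRec α β 1 (β 0) n * u)
        (cfRec α β 0 1 (n + 1) * v + cfRec α β 0 1 n * u) := by
  induction n generalizing u v with
  | zero =>
    by_cases hv : v = 0
    · simp [cfApprox, cfRec, extDiv, hv]
    · simp only [cfApprox, cfRec, extDiv, hv, zero_mul, one_mul, add_zero, if_false,
        OnePoint.map_some]
      congr 1
      field_simp
  | succ n ih =>
    have huv : u ≠ 0 ∨ v ≠ 0 := by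
      by_contra! h0
      simp [h0] at h
    have hR (x y : ℂ) : cfRec α β x y (n + 1 + 1) * v + cfRec α β x y (n + 1) * u =
        cfRec α β x y (n + 1) * (β (n + 1) * v + u) + cfRec α β x y n * (α (n + 1) * v) := by
      rw [cfRec_add_two]; ring
    rw [hR, hR] at h ⊢
    rw [cfApprox]
    by_cases hα : α (n + 1) = 0
    · -- The map is constant here, and the factor `β v + u` cancels from the coordinates.
      simp only [hα, zero_mul, mul_zero, add_zero] at h ⊢
      have hk : β (n + 1) * v + u ≠ 0 := by
        rcases h with h | h <;> exact right_ne_zero_of_mul h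
      have h01 : ((0 : ℂ) : OnePoint ℂ) = extDiv 0 1 := by simp [extDiv]
      rw [extDiv_mul_right hk, cfMap, if_pos rfl, h01, ih 0 1]
      · simp
      · simpa using h.imp left_ne_zero_of_mul left_ne_zero_of_mul
    · rw [cfMap_extDiv hα _ huv]
      exact ih _ _ h

theorem cfApprox_zero_eq_extDiv (α β : ℕ → ℂ) (n : ℕ)
    (h : cfRec α β 1 (β 0) (n + 1) ≠ 0 ∨ cfRec α β 0 1 (n + 1) ≠ 0) :
    cfApprox α β n ((0 : ℂ) : OnePoint ℂ) =
      extDiv (cfRec α β 1 (β 0) (n + 1)) (cfRec α β 0 1 (n + 1)) := by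
  have := cfApprox_extDiv α β n 0 1 (by simpa using h)
  simpa [extDiv] using this

/-- If `H` solves the recurrence backwards, its pairing with `cfRec` does not depend on the index:
it is the product of the partial matrix product with the remaining tail. -/
theorem cfRec_pairing (α β : ℕ → ℂ) (x y : ℂ) {H : ℕ → ℂ}
    (hH : ∀ n, H n = β (n + 1) * H (n + 1) + α (n + 2) * H (n + 2)) (n : ℕ) :
    cfRec α β x y (n + 1) * H n + α (n + 1) * cfRec α β x y n * H (n + 1) =
      y * H 0 + α 1 * x * H 1 := by
  induction n with
  | zero => simp [cfRec]
  | succ n ih =>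
    rw [← ih, cfRec_add_two, hH n]
    ring

/-- A Pincherle-type criterion. Suppose that `H n = F n / D n` solves the recurrence backwards, that
`F n → g ≠ 0`, and that the partial numerators, rescaled by `D`, tend to `l` with `‖l‖ < 1`. Then the
continued fraction converges, and its value is read off from `H 0` and `H 1`. -/
theorem cfConvergesTo_of_backward_solution {α β F D : ℕ → ℂ} {g l : ℂ} (hD : ∀ n, D n ≠ 0)
    (hH : ∀ n, F n / D n = β (n + 1) * (F (n + 1) / D (n + 1)) + α (n + 2) * (F (n + 2) / D (n + 2)))
    (hF : Tendsto F atTop (𝓝 g)) (hg : g ≠ 0)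
    (hα : Tendsto (fun n => α (n + 2) * D n / D (n + 2)) atTop (𝓝 l)) (hl : ‖l‖ < 1)
    (h0 : β 0 * (F 0 / D 0) + α 1 * (F 1 / D 1) ≠ 0 ∨ F 0 / D 0 ≠ 0) :
    CFConvergesTo α β (extDiv (β 0 * (F 0 / D 0) + α 1 * (F 1 / D 1)) (F 0 / D 0)) := by
  have hF1 := (tendsto_add_atTop_iff_nat 1).mpr hF
  have hF2 := (tendsto_add_atTop_iff_nat 2).mpr hF
  have hlim (x y : ℂ) : Tendsto (fun n => cfRec α β x y (n + 1) / D n) atTop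
      (𝓝 ((y * (F 0 / D 0) + α 1 * x * (F 1 / D 1)) * (g * (1 + l))⁻¹)) := by
    have hinv := cfRec_pairing α β x y (H := fun n => F n / D n) hH
    set c := y * (F 0 / D 0) + α 1 * x * (F 1 / D 1)
    have hu : Tendsto (fun n => c / F (n + 1)) atTop (𝓝 (c / g)) := tendsto_const_nhds.div hF1 hg
    have hv : Tendsto (fun n => -(α (n + 2) * D n / D (n + 2) * (F (n + 2) / F (n + 1)))) atTop
        (𝓝 (-l)) := by
      have := (hα.mul (hF2.div hF1 hg)).neg
      rwa [div_self hg, mul_one] at this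
    have key := tendsto_of_affine_recursion
      (x := fun n => cfRec α β x y (n + 1) / D n) ?_ hu hv (by simpa using hl)
    · refine key.trans_eq ?_
      rw [sub_neg_eq_add, div_div, div_eq_mul_inv]
    · filter_upwards [hF1.eventually_ne hg] with n hn
      have h1 := hinv (n + 1)
      have hD0 := hD n
      have hD1 := hD (n + 1)
      have hD2 := hD (n + 2)
      rw [← show _ = c from h1, add_assoc n 1 1]
      field_simp
      ring
  have hl1 : 1 + l ≠ 0 := by
    intro h
    rw [eq_neg_of_add_eq_zero_right h] at hl
    simp at hl
  have hk : (g * (1 + l))⁻¹ ≠ 0 := inv_ne_zero (mul_ne_zero hg hl1)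
  have hA := hlim 1 (β 0)
  have hB := hlim 0 1
  rw [mul_one] at hA
  rw [mul_zero, zero_mul, add_zero, one_mul] at hB
  have h0' := h0.imp (mul_ne_zero · hk) (mul_ne_zero · hk)
  have hlimit := tendsto_extDiv hA hB h0'
  rw [extDiv_mul_right hk] at hlimit
  refine hlimit.congr' ?_
  have hne : ∀ᶠ n in atTop, cfRec α β 1 (β 0) (n + 1) / D n ≠ 0 ∨
      cfRec α β 0 1 (n + 1) / D n ≠ 0 := by
    rcases h0' with h | h
    · exact (hA.eventually_ne h).mono fun _ => Or.inl
    · exact (hB.eventually_ne h).mono fun _ => Or.inr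
  filter_upwards [hne] with n hn
  rw [cfApprox_zero_eq_extDiv α β n (hn.imp (fun h => (div_ne_zero_iff.mp h).1)
    (fun h => (div_ne_zero_iff.mp h).1)), div_eq_mul_inv, div_eq_mul_inv,
    extDiv_mul_right (inv_ne_zero (hD n))]

/-! ### The numerator and denominator series do not both vanish -/

theorem twoPhiOne_one_left (A C p z : ℂ) : twoPhiOne A 1 C p z = 1 := by
  rw [twoPhiOne, tsum_eq_single 0 fun k hk => ?_, twoPhiOneTerm_zero]
  obtain ⟨k, rfl⟩ := Nat.exists_eq_succ_of_ne_zero hk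
  simp [twoPhiOneTerm, qRising_one_succ]

theorem twoPhiOne_cancel {C p : ℂ} (hC : ∀ j : ℕ, 1 - C * p ^ j ≠ 0) (B z : ℂ) :
    twoPhiOne C B C p z = twoPhiOne B 0 0 p z := by
  refine tsum_congr fun k => ?_
  have := qRising_ne_zero hC k
  simp only [twoPhiOneTerm, qRising_zero_left, mul_one]
  rw [mul_comm (qRising C p k), mul_div_mul_right _ _ this]

/-- Where the coefficient of the recurrence vanishes, the next series is either identically `1` or
reduces to a `₁φ₀`. -/
theorem contiguousSeries_succ_ne_zero {A p z : ℂ} (hp0 : p ≠ 0) (hp : ‖p‖ < 1) (hz : ‖z‖ < 1)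
    {n : ℕ} (h : (1 + A * p ^ n) * (A + p ^ (n + 1)) = 0) :
    contiguousSeries A p z (n + 1) ≠ 0 := by
  have hB : -(A * p ^ (n + 1) / p) = -(A * p ^ n) := by
    rw [pow_succ]; field_simp
  rw [contiguousSeries, hB]
  rcases mul_eq_zero.mp h with h | h
  · rw [show -(A * p ^ n) = 1 by linear_combination -h, twoPhiOne_one_left]
    exact one_ne_zero
  · rw [eq_neg_of_add_eq_zero_left h, twoPhiOne_cancel]
    · refine twoPhiOne_zero_zero_ne_zero hp hz ?_
      rw [neg_mul, neg_mul, neg_mul, neg_neg, ← pow_add, norm_mul, norm_pow]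
      exact mul_lt_one_of_nonneg_of_lt_one_right (pow_le_one₀ (norm_nonneg _) hp.le)
        (norm_nonneg _) hz
    · intro j
      rw [neg_mul, sub_neg_eq_add, ← pow_add]
      exact one_add_pow_ne_zero hp _

theorem not_contiguousSeries_zero_and_one {A p z : ℂ} (hp0 : p ≠ 0) (hp : ‖p‖ < 1) (hz : ‖z‖ < 1)
    (hAz : ‖A * z‖ < 1) :
    ¬ (contiguousSeries A p z 0 = 0 ∧ contiguousSeries A p z 1 = 0) := by
  intro h
  by_cases hz0 : z = 0
  · refine one_ne_zero (α := ℂ) (h.1 ▸ ?_)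
    rw [contiguousSeries, twoPhiOne, tsum_eq_single 0 fun k hk => ?_, twoPhiOneTerm_zero]
    simp [twoPhiOneTerm, hz0, hk]
  have hall (n : ℕ) : contiguousSeries A p z n = 0 ∧ contiguousSeries A p z (n + 1) = 0 := by
    induction n with
    | zero => exact h
    | succ n ih =>
      refine ⟨ih.2, ?_⟩
      have hrec := contiguousSeries_recurrence (A := A) hp0 hp hz n
      rw [ih.1, ih.2, mul_zero, zero_sub, zero_eq_neg] at hrec
      refine (mul_eq_zero.mp hrec).resolve_left fun h0 => ?_
      refine contiguousSeries_succ_ne_zero hp0 hp hz ?_ ih.2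
      have hne : p * ((1 + p ^ n) * (1 + p ^ (n + 1))) ≠ 0 :=
        mul_ne_zero hp0 (mul_ne_zero (one_add_pow_ne_zero hp _) (one_add_pow_ne_zero hp _))
      have h1 := (div_eq_zero_iff.mp h0).resolve_right hne
      rw [mul_assoc] at h1
      exact (mul_eq_zero.mp h1).resolve_left hz0
  have hlim := tendsto_contiguousSeries (A := A) hp0 hp hz
  rw [show contiguousSeries A p z = fun _ => 0 from funext fun n => (hall n).1] at hlim
  exact twoPhiOne_zero_zero_ne_zero hp hz hAz (tendsto_nhds_unique hlim tendsto_const_nhds)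

/-! ### The value of the continued fraction -/

theorem mainTheorem2 (a b q : ℂ) (ha : a ≠ 0) (hq0 : q ≠ 0)
    (hq : ‖q‖ < 1) (hab : ‖a * b‖ < 1) (haq : ‖a ^ 2 * q‖ < 1) :
    -- both basic hypergeometric series converge,
    Summable (twoPhiOneTerm (-(b * q / a)) (b * q / a) (-q ^ 2) (q ^ 2) (a ^ 2 * q)) ∧
    Summable (twoPhiOneTerm (-(b * q / a)) (b / (a * q)) (-1) (q ^ 2) (a ^ 2 * q)) ∧
    -- their sums do not both vanish, so that the ratio is a definite extended complex number,
    ¬ (twoPhiOne (-(b * q / a)) (b * q / a) (-q ^ 2) (q ^ 2) (a ^ 2 * q) = 0 ∧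
        twoPhiOne (-(b * q / a)) (b / (a * q)) (-1) (q ^ 2) (a ^ 2 * q) = 0) ∧
    -- and `H(1)` converges to the stated value.
    HConvergesTo a b q 1
      (extDiv
        ((1 - a * b) / 2 *
          twoPhiOne (-(b * q / a)) (b * q / a) (-q ^ 2) (q ^ 2) (a ^ 2 * q))
        (twoPhiOne (-(b * q / a)) (b / (a * q)) (-1) (q ^ 2) (a ^ 2 * q))) := by
  have hp0 : q ^ 2 ≠ 0 := pow_ne_zero 2 hq0
  have hp : ‖q ^ 2‖ < 1 := by
    rw [norm_pow]; exact pow_lt_one₀ (norm_nonneg _) hq two_ne_zero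
  have hAz : ‖-(b * q / a) * (a ^ 2 * q)‖ < 1 := by
    rw [show -(b * q / a) * (a ^ 2 * q) = -((a * b) * q ^ 2) by field_simp, norm_neg, norm_mul]
    exact mul_lt_one_of_nonneg_of_lt_one_left (norm_nonneg _) hab hp.le
  set F := contiguousSeries (-(b * q / a)) (q ^ 2) (a ^ 2 * q) with hF
  have hF0 : twoPhiOne (-(b * q / a)) (b / (a * q)) (-1) (q ^ 2) (a ^ 2 * q) = F 0 := by
    rw [hF, contiguousSeries, pow_zero]
    congr 1
    field_simp
  have hF1 : twoPhiOne (-(b * q / a)) (b * q / a) (-q ^ 2) (q ^ 2) (a ^ 2 * q) = F 1 := by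
    rw [hF, contiguousSeries, pow_one]
    congr 1
    field_simp
  refine ⟨summable_twoPhiOneTerm _ _ _ hp haq, summable_twoPhiOneTerm _ _ _ hp haq, ?_, ?_⟩
  · rw [hF0, hF1, and_comm]
    exact not_contiguousSeries_zero_and_one hp0 hp haq hAz
  rw [hF0, hF1]
  -- The factors `1 + q²ⁿ` of the partial denominators are absorbed by the scaling `(-1; q²)_n`.
  set D := qRising (-1) (q ^ 2) with hDdef
  have hsucc (n : ℕ) : D (n + 1) = D n * (1 + (q ^ 2) ^ n) := by
    rw [hDdef, qRising_succ]; ring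
  have hD (n : ℕ) : D n ≠ 0 := qRising_ne_zero (fun j => by
    simpa using one_add_pow_ne_zero hp j) n
  have hD0 : D 0 = 1 := qRising_zero _ _
  have hD1 : D 1 = 2 := by rw [hsucc, hD0, pow_zero]; norm_num
  have hval : extDiv ((1 - a * b) / 2 * F 1) (F 0) =
      extDiv (hDen a b q 1 0 * (F 0 / D 0) + hNum a b q 1 * (F 1 / D 1)) (F 0 / D 0) := by
    simp only [hDen, hNum, hD0, hD1, zero_mul, zero_add, div_one]
    congr 1
    ring
  rw [HConvergesTo, hval]
  refine cfConvergesTo_of_backward_solution (l := a * b) hD (fun n => ?_)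
    (tendsto_contiguousSeries hp0 hp haq) (twoPhiOne_zero_zero_ne_zero hp haq hAz) ?_ hab ?_
  · have hrec := contiguousSeries_recurrence (A := -(b * q / a)) hp0 hp haq n
    rw [← hF] at hrec
    have h0 := hD n
    have h1 := one_add_pow_ne_zero hp n
    have h2 := one_add_pow_ne_zero hp (n + 1)
    rw [hrec, hsucc (n + 1), hsucc n]
    simp only [hDen, hNum, pow_succ q (2 * n), pow_succ (q ^ 2) n, pow_mul] at h1 h2 ⊢
    generalize (q ^ 2) ^ n = t at *
    field_simp
    ring
  · have hpow (c : ℂ) : Tendsto (fun n : ℕ => c * (q ^ 2) ^ n) atTop (𝓝 0) := tendsto_mul_pow hp c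
    have hlim := (((hpow (b * q)).const_sub a).mul ((hpow (a * q)).const_sub b)).div
      (((hpow 1).const_add 1).mul ((hpow (q ^ 2)).const_add 1)) (by simp)
    refine (hlim.congr fun n => ?_).trans_eq (by simp)
    have h0 := hD n
    have h1 := one_add_pow_ne_zero hp n
    have h2 := one_add_pow_ne_zero hp (n + 1)
    rw [hsucc (n + 1), hsucc n]
    simp only [hNum, Pi.div_apply, pow_succ q (2 * n), pow_succ' (q ^ 2) n, pow_mul,
      one_mul] at h1 h2 ⊢
    generalize (q ^ 2) ^ n = t at *
    field_simp
  · have hnz := not_contiguousSeries_zero_and_one hp0 hp haq hAz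
    have hc : 1 - a * b ≠ 0 := by
      intro h
      rw [← sub_eq_zero.mp h] at hab
      simp at hab
    rw [← hF] at hnz
    by_contra! h
    simp only [hDen, hNum, hD0, hD1, zero_mul, zero_add, div_one] at h
    exact hnz ⟨h.2, by simpa [hc] using h.1⟩
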